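/- Let $\Bbbk$ be a field and let $A$ be an associative unital $\Bbbk$-algebra that is profinite, i.e. isomorphic to the inverse limit $\varprojlim_{i\in I}F_i$ of an inverse system, indexed by a directed set $I$, of finite-dimensional $\Bbbk$-algebras $F_i$ and $\Bbbk$-algebra homomorphisms. Suppose that $A$ is semiprimary (its Jacobson radical $J$ is nilpotent and $A/J$ is a semisimple ring) and left self-injective ($A$ is injective as a left $A$-module). Then $A$ is finite-dimensional over $\Bbbk$, and $A$ is a quasi-Frobenius (QF) ring, i.e. $A$ is left and right self-injective and left and right artinian. -/

import Mathlib

universe u v w w'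

/-- The inverse limit of an inverse system `F` of `k`-algebras with transition maps
`f : F j → F i` for `i ≤ j`: the subalgebra of compatible families in the product. -/
def inverseLimit {k : Type u} [Field k] {ι : Type w} [Preorder ι] {F : ι → Type w'}
    [∀ i, Ring (F i)] [∀ i, Algebra k (F i)] (f : ∀ ⦃i j : ι⦄, i ≤ j → (F j →ₐ[k] F i)) :
    Subalgebra k (∀ i, F i) where
  carrier := {x | ∀ ⦃i j : ι⦄ (h : i ≤ j), f h (x j) = x i}
  mul_mem' hx hy i j h := by simp [hx h, hy h]
  add_mem' hx hy i j h := by simp [hx h, hy h]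
  algebraMap_mem' r i j h := by simp

/-- A `k`-algebra is profinite if it is isomorphic to the inverse limit of an inverse system,
indexed by a directed set, of finite-dimensional `k`-algebras and `k`-algebra homomorphisms. -/
def IsProfiniteAlgebra (k : Type u) (A : Type v) [Field k] [Ring A] [Algebra k A] : Prop :=
  ∃ (ι : Type w) (_ : Preorder ι) (_ : Nonempty ι) (_ : IsDirectedOrder ι)
    (F : ι → Type w') (_ : ∀ i, Ring (F i)) (_ : ∀ i, Algebra k (F i))
    (f : ∀ ⦃i j : ι⦄, i ≤ j → (F j →ₐ[k] F i)),
    InverseSystem (fun i j (h : i ≤ j) => ⇑(f h)) ∧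
    (∀ i, FiniteDimensional k (F i)) ∧
    Nonempty (A ≃ₐ[k] inverseLimit f)

/-- A ring is left self-injective if it is injective as a left module over itself. -/
def IsLeftSelfInjective (R : Type v) [Ring R] : Prop :=
  Module.Injective R R

/-- A ring is right self-injective if it is injective as a right module over itself;
right `R`-modules are modules over the opposite ring. -/
def IsRightSelfInjective (R : Type v) [Ring R] : Prop :=
  Module.Injective Rᵐᵒᵖ R

/-- A ring is quasi-Frobenius (QF) if it is left and right self-injective and left and right
artinian. -/
structure IsQuasiFrobeniusRing (R : Type v) [Ring R] : Prop where
  left_selfInjective : IsLeftSelfInjective R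
  right_selfInjective : IsRightSelfInjective R
  left_artinian : IsArtinian R R
  right_artinian : IsArtinian Rᵐᵒᵖ R

/-!
Write `J` for the Jacobson radical of the ring and `S = {x | J x = 0}` for its left socle.

*Finite dimension.* If `R` is semiprimary and left self-injective, then `S` is a semisimple left
module which is essential in `R`, because `J` is nilpotent. Injectivity shows that every
endomorphism of `S` is a right multiplication. This gives `S J = 0`, and it shows that
`T ↦ {c | T c = 0}` is a strictly antitone map from the left submodules of `S` to the right ideals
containing `J`; as `R ⧸ J` is right noetherian, `S` is an artinian left module
(`isArtinian_leftSocle`). Hence a downward directed family of left ideals with zero intersection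
contains the zero ideal: among its intersections with `S` there is a least one, it is zero, and `S`
is essential (`exists_eq_bot_of_directed`). Apply this to the kernels of the projections `A → F i`
of a profinite algebra: one of the projections is injective.

*Right self-injectivity.* Let `R` be artinian on the left, noetherian on the right and left
self-injective. Injectivity gives the double annihilator property for right ideals
(`exists_mem_mul_eq_of_annihilates`), also relative to `S`, where the right annihilator of `S`
is `J`. The map `X ↦ l(S ∩ l(X))`, with `l` the left annihilator, is therefore strictly monotone
on two-sided ideals containing `J`; since `R` is noetherian it has to fix the least of them, and
it follows that `l(S) = J` (`leftAnn_leftSocle_le`). So all simple left modules embed in `R`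
(`exists_ne_zero_annihilated`), and `R` is an injective cogenerator: left ideals also have the
double annihilator property (`exists_annihilator_mul_ne_zero`). The two annihilator properties
give `l(X ∩ Y) = l(X) + l(Y)` for right ideals, and Baer's criterion on the right follows by
induction on the number of generators of a right ideal (`injective_mulOpposite`).
-/

namespace SelfInjective

/-! ### Annihilators and the left socle -/

section Annihilators

variable {R : Type v} [Ring R]

/-- The left annihilator `{a | ∀ x ∈ X, a * x = 0}` of a subset of a ring. -/
def leftAnn (X : Set R) : Ideal R where
  carrier := {a | ∀ x ∈ X, a * x = 0}
  add_mem' ha hb x hx := by rw [add_mul, ha x hx, hb x hx, add_zero]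
  zero_mem' x _ := zero_mul x
  smul_mem' c a ha x hx := by rw [smul_eq_mul, mul_assoc, ha x hx, mul_zero]

lemma mem_leftAnn {X : Set R} {a : R} : a ∈ leftAnn X ↔ ∀ x ∈ X, a * x = 0 := Iff.rfl

lemma leftAnn_anti {X Y : Set R} (h : X ⊆ Y) : leftAnn Y ≤ leftAnn X :=
  fun _ ha x hx ↦ ha x (h hx)

instance isTwoSided_leftAnn (X : Ideal R) : (leftAnn (X : Set R)).IsTwoSided where
  mul_mem_of_left b ha x hx := by rw [mul_assoc]; exact ha _ (X.mul_mem_left b hx)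

variable (R) in
/-- The left socle of a ring `R`, encoded as the set of elements killed by the Jacobson radical
from the left. It is the sum of the simple left ideals when `R` is semisimple modulo its
Jacobson radical. -/
def leftSocle : Ideal R where
  carrier := {x | ∀ a ∈ Ring.jacobson R, a * x = 0}
  add_mem' hx hy a ha := by rw [mul_add, hx a ha, hy a ha, add_zero]
  zero_mem' a _ := mul_zero a
  smul_mem' c x hx a ha := by
    rw [smul_eq_mul, ← mul_assoc]
    exact hx _ (Ideal.mul_mem_right c _ ha)

lemma mem_leftSocle {x : R} : x ∈ leftSocle R ↔ ∀ a ∈ Ring.jacobson R, a * x = 0 := Iff.rfl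

instance isTwoSided_leftSocle : (leftSocle R).IsTwoSided where
  mul_mem_of_left b hx a ha := by rw [← mul_assoc, hx a ha, zero_mul]

instance isSemisimpleModule_leftSocle [IsSemiprimaryRing R] :
    IsSemisimpleModule R (leftSocle R) := by
  have h : Module.IsTorsionBySet R (leftSocle R) (Ring.jacobson R : Set R) :=
    fun x a ↦ Subtype.ext (x.2 a.1 a.2)
  let := h.module
  exact h.isSemisimpleModule_iff.mp inferInstance

/-- The left socle of a semiprimary ring is essential. -/
lemma exists_mem_leftSocle [IsSemiprimaryRing R] {K : Ideal R} (hK : K ≠ ⊥) :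
    ∃ y ∈ K, y ∈ leftSocle R ∧ y ≠ 0 := by
  obtain ⟨n, hn⟩ := IsSemiprimaryRing.isNilpotent (R := R)
  have key : ∀ n : ℕ, ∀ x ∈ K, x ≠ 0 → (∀ a ∈ Ring.jacobson R ^ n, a * x = 0) →
      ∃ y ∈ K, y ∈ leftSocle R ∧ y ≠ 0 := by
    intro n
    induction n with
    | zero =>
      intro x _ hx0 h
      have := h 1 (by rw [Submodule.pow_zero, Ideal.one_eq_top]; trivial)
      exact absurd (by simpa using this) hx0
    | succ n ih =>
      intro x hx hx0 h
      by_cases hs : x ∈ leftSocle R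
      · exact ⟨x, hx, hs, hx0⟩
      · rw [mem_leftSocle] at hs
        push Not at hs
        obtain ⟨a, ha, hax⟩ := hs
        refine ih (a * x) (K.mul_mem_left a hx) hax fun b hb ↦ ?_
        rw [← mul_assoc]
        exact h _ (by rw [Submodule.pow_succ]; exact Ideal.mul_mem_mul hb ha)
  obtain ⟨x, hx, hx0⟩ := Submodule.exists_mem_ne_zero_of_ne_bot hK
  refine key n x hx hx0 fun a ha ↦ ?_
  rw [hn] at ha
  rw [show a = 0 from ha, zero_mul]

end Annihilators

/-! ### Extending homomorphisms into a self-injective ring -/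

section Extension

variable {R : Type v} [Ring R] [Module.Injective R R]

lemma exists_extension {Y Z : Type v} [AddCommGroup Y] [Module R Y] [AddCommGroup Z] [Module R Z]
    (f : Y →ₗ[R] Z) (g : Y →ₗ[R] R) (h : LinearMap.ker f ≤ LinearMap.ker g) :
    ∃ e : Z →ₗ[R] R, ∀ y, e (f y) = g y := by
  obtain ⟨e, he⟩ := Module.Injective.out ((LinearMap.ker f).liftQ f le_rfl)
    (LinearMap.ker_eq_bot.mp (Submodule.ker_liftQ_eq_bot _ _ _ le_rfl))
    ((LinearMap.ker f).liftQ g h)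
  exact ⟨e, fun y ↦ he (Submodule.Quotient.mk y)⟩

lemma exists_eq_mul {Y : Type v} [AddCommGroup Y] [Module R Y]
    (f g : Y →ₗ[R] R) (h : LinearMap.ker f ≤ LinearMap.ker g) :
    ∃ b : R, ∀ y, g y = f y * b := by
  obtain ⟨e, he⟩ := exists_extension f g h
  refine ⟨e 1, fun y ↦ ?_⟩
  rw [← he, ← smul_eq_mul, ← map_smul, smul_eq_mul, mul_one]

/-- The double annihilator property of a finitely generated right ideal `X`, relative to a left
ideal `N`. For `N = ⊤` it says that `X` is the right annihilator of its left annihilator. -/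
lemma exists_mem_mul_eq_of_annihilates (N : Ideal R) {X : Ideal Rᵐᵒᵖ} (hX : X.FG) {a : R}
    (h : ∀ s ∈ N, (∀ x ∈ X, s * x.unop = 0) → s * a = 0) :
    ∃ y ∈ X, ∀ s ∈ N, s * a = s * y.unop := by
  obtain ⟨n, x, rfl⟩ := Submodule.fg_iff_exists_fin_generating_family.mp hX
  let f : N →ₗ[R] (Fin n → R) :=
    LinearMap.pi fun i ↦ (LinearMap.toSpanSingleton R R (x i).unop) ∘ₗ N.subtype
  let g : N →ₗ[R] R := (LinearMap.toSpanSingleton R R a) ∘ₗ N.subtype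
  have hfg : LinearMap.ker f ≤ LinearMap.ker g := by
    intro s hs
    refine h s s.2 fun z hz ↦ ?_
    induction hz using Submodule.span_induction with
    | mem z hz =>
      obtain ⟨i, rfl⟩ := hz
      exact congrFun hs i
    | zero => simp
    | add u v _ _ hu hv => rw [MulOpposite.unop_add, mul_add, hu, hv, add_zero]
    | smul c u _ hu => rw [smul_eq_mul, MulOpposite.unop_mul, ← mul_assoc, hu, zero_mul]
  obtain ⟨e, he⟩ := exists_extension f g hfg
  refine ⟨∑ i, MulOpposite.op (e (Pi.single i 1)) • x i,
    Submodule.sum_mem _ fun i _ ↦ Submodule.smul_mem _ _ (Submodule.subset_span ⟨i, rfl⟩),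
    fun s hs ↦ ?_⟩
  have h1 : s * a = e (f ⟨s, hs⟩) := (he ⟨s, hs⟩).symm
  rw [h1, LinearMap.pi_apply_eq_sum_univ e, Finset.unop_sum, Finset.mul_sum]
  refine Finset.sum_congr rfl fun i _ ↦ ?_
  have h2 : (fun j ↦ if i = j then (1 : R) else 0) = Pi.single i 1 := by
    ext j
    simp [Pi.single_apply, eq_comm]
  rw [h2]
  simp [f, mul_assoc]

end Extension

/-! ### The left socle of a semiprimary left self-injective ring -/

section Socle

variable {R : Type v} [Ring R] [Module.Injective R R] [IsSemiprimaryRing R]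

/-- The left socle is also killed by the Jacobson radical from the right: right multiplication by
`a ∈ J` is inverted on a complement of its kernel in `S` by right multiplication by some `b`, while
`1 - a b` is a unit, so this complement is zero. -/
lemma mul_eq_zero_of_mem_leftSocle {x a : R} (hx : x ∈ leftSocle R)
    (ha : a ∈ Ring.jacobson R) : x * a = 0 := by
  let f : leftSocle R →ₗ[R] R := (LinearMap.toSpanSingleton R R a) ∘ₗ (leftSocle R).subtype
  obtain ⟨C, hC⟩ := exists_isCompl (LinearMap.ker f)
  -- The projection onto a complement of the kernel of `· * a` factors through `· * a`.
  obtain ⟨b, hb⟩ := exists_eq_mul f 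
      ((leftSocle R).subtype ∘ₗ (C.projection _ hC.symm : leftSocle R →ₗ[R] leftSocle R)) (by
    intro y hy
    rw [LinearMap.mem_ker, LinearMap.comp_apply,
      (Submodule.projection_apply_eq_zero_iff hC.symm).mpr hy, map_zero])
  let y : leftSocle R := C.projection _ hC.symm ⟨x, hx⟩
  have hy : (y : R) = y * a * b := by
    have := hb y
    rwa [LinearMap.comp_apply, Submodule.projection_apply_of_mem_left hC.symm
      (Submodule.projection_apply_mem hC.symm _)] at this
  have hunit : IsUnit (1 - a * b) := by
    obtain ⟨n, hn⟩ := IsSemiprimaryRing.isNilpotent (R := R)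
    refine IsNilpotent.isUnit_one_sub ⟨n, ?_⟩
    have := Ideal.pow_mem_pow (Ideal.mul_mem_right b _ ha) n
    rwa [hn] at this
  have hy0 : y = 0 := by
    refine Subtype.ext (hunit.mul_left_eq_zero.mp ?_)
    rw [mul_sub, mul_one, ← mul_assoc, ← hy, sub_self]
  exact (Submodule.projection_apply_eq_zero_iff hC.symm).mp hy0

lemma exists_mul_ne_zero_of_notMem {T : Submodule R (leftSocle R)} {x : leftSocle R}
    (hx : x ∉ T) : ∃ c : R, (∀ t ∈ T, (t : R) * c = 0) ∧ (x : R) * c ≠ 0 := by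
  obtain ⟨C, hC⟩ := exists_isCompl T
  obtain ⟨c, hc⟩ := exists_eq_mul (leftSocle R).subtype
    ((leftSocle R).subtype ∘ₗ C.projection T hC.symm) (by
      rw [Submodule.ker_subtype]; exact bot_le)
  refine ⟨c, fun t ht ↦ ?_, fun h ↦ hx ?_⟩
  · refine (hc t).symm.trans ?_
    rw [LinearMap.comp_apply, (Submodule.projection_apply_eq_zero_iff hC.symm).mpr ht, map_zero]
  · exact (Submodule.projection_apply_eq_zero_iff hC.symm).mp (Subtype.ext ((hc x).trans h))

/-- The right annihilator of a submodule of the left socle, as a right ideal of the quotient by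
the Jacobson radical. It contains the radical because `S J = 0`. Right ideals are encoded as left
ideals of the opposite ring. -/
def quotientRightAnn (T : Submodule R (leftSocle R)) : Ideal (R ⧸ Ring.jacobson R)ᵐᵒᵖ where
  carrier := {z | ∀ a : R, Ideal.Quotient.mk (Ring.jacobson R) a = z.unop →
    ∀ t ∈ T, (t : R) * a = 0}
  add_mem' {y z} hy hz a ha t ht := by
    obtain ⟨b, hb⟩ := Ideal.Quotient.mk_surjective y.unop
    have h := hz (a - b) (by rw [map_sub, ha, hb, MulOpposite.unop_add, add_sub_cancel_left]) t ht
    rwa [mul_sub, hy b hb t ht, sub_zero] at h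
  zero_mem' a ha t _ := mul_eq_zero_of_mem_leftSocle t.2 (Ideal.Quotient.eq_zero_iff_mem.mp ha)
  smul_mem' c z hz a ha t ht := by
    obtain ⟨b, hb⟩ := Ideal.Quotient.mk_surjective z.unop
    obtain ⟨d, hd⟩ := Ideal.Quotient.mk_surjective c.unop
    have h := mul_eq_zero_of_mem_leftSocle t.2 (a := a - b * d) (by
      rw [← Ideal.Quotient.eq_zero_iff_mem, map_sub, map_mul, ha, hb, hd]
      simp)
    rwa [mul_sub, ← mul_assoc, hz b hb t ht, zero_mul, sub_zero] at h

lemma strictAnti_quotientRightAnn : StrictAnti (quotientRightAnn (R := R)) := by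
  intro T U hTU
  refine SetLike.lt_iff_le_and_exists.mpr ⟨fun z hz a ha t ht ↦ hz a ha t (hTU.le ht), ?_⟩
  obtain ⟨x, hxU, hxT⟩ := SetLike.exists_of_lt hTU
  obtain ⟨c, hc, hxc⟩ := exists_mul_ne_zero_of_notMem hxT
  refine ⟨MulOpposite.op (Ideal.Quotient.mk _ c), fun a ha t ht ↦ ?_,
    fun h ↦ hxc (h c rfl x hxU)⟩
  have h := mul_eq_zero_of_mem_leftSocle t.2 (Ideal.Quotient.eq.mp ha)
  rwa [mul_sub, hc t ht, sub_zero] at h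

instance isArtinian_leftSocle : IsArtinian R (leftSocle R) :=
  strictAnti_quotientRightAnn.wellFoundedLT

/-- In a semiprimary left self-injective ring, a downward directed family of left ideals with zero
intersection contains the zero ideal. -/
theorem exists_eq_bot_of_directed {ι : Type*} [Nonempty ι] (K : ι → Ideal R)
    (hdir : Directed (· ≥ ·) K) (hK : ⨅ i, K i = ⊥) : ∃ i, K i = ⊥ := by
  let L : ι → Submodule R (leftSocle R) := fun i ↦ Submodule.comap (leftSocle R).subtype (K i)
  obtain ⟨_, ⟨i, rfl⟩, hmin⟩ := WellFounded.has_min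
    (wellFounded_lt (α := Submodule R (leftSocle R))) (Set.range L) (Set.range_nonempty L)
  refine ⟨i, by_contra fun hi ↦ ?_⟩
  obtain ⟨y, hyK, hyS, hy0⟩ := exists_mem_leftSocle hi
  refine hy0 ((Submodule.mem_bot R).mp (hK ▸ (Submodule.mem_iInf K).mpr fun j ↦ ?_))
  obtain ⟨l, hli, hlj⟩ := hdir i j
  have hle : L l ≤ L i := Submodule.comap_mono hli
  have heq : L l = L i := by_contra fun hne ↦ hmin _ ⟨l, rfl⟩ (lt_of_le_of_ne hle hne)
  have hy : (⟨y, hyS⟩ : leftSocle R) ∈ L l := heq ▸ hyK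
  exact hlj hy

end Socle

/-! ### Double annihilators of left ideals -/

section DoubleAnnihilator

variable {R : Type v} [Ring R]

/-- The right annihilator of the left socle is contained in the Jacobson radical: if `S a = 0`,
right multiplication by `1 + y a` is the identity on the essential left ideal `S`, hence injective,
hence surjective. -/
lemma mem_jacobson_of_leftSocle_mul_eq_zero [IsArtinianRing R] {a : R}
    (h : ∀ s ∈ leftSocle R, s * a = 0) :
    a ∈ Ring.jacobson R := by
  rw [← Ideal.jacobson_bot, Ideal.mem_jacobson_iff]
  intro y
  let f : R →ₗ[R] R := LinearMap.toSpanSingleton R R (y * a + 1)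
  have hf : Function.Injective f := by
    rw [← LinearMap.ker_eq_bot]
    by_contra hne
    obtain ⟨s, hs, hsS, hs0⟩ := exists_mem_leftSocle hne
    refine hs0 ?_
    have hs' : s * (y * a + 1) = 0 := hs
    rwa [mul_add, mul_one, ← mul_assoc, h _ (Ideal.mul_mem_right y _ hsS), zero_add] at hs'
  obtain ⟨z, hz⟩ := IsArtinian.surjective_of_injective_endomorphism f hf 1
  have hz' : z * (y * a + 1) = 1 := hz
  refine ⟨z, ?_⟩
  rw [Submodule.mem_bot, ← hz']
  noncomm_ring

variable [Module.Injective R R] [IsNoetherianRing Rᵐᵒᵖ]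

/-- `exists_mem_mul_eq_of_annihilates` for a two-sided ideal. -/
lemma exists_mem_mul_eq_of_annihilates_twoSided (N X : Ideal R) [X.IsTwoSided] {a : R}
    (h : ∀ s ∈ N, s ∈ leftAnn (X : Set R) → s * a = 0) :
    ∃ y ∈ X, ∀ s ∈ N, s * a = s * y := by
  let X' : Ideal Rᵐᵒᵖ :=
    { carrier := {x | x.unop ∈ X}
      add_mem' := X.add_mem
      zero_mem' := X.zero_mem
      smul_mem' := fun c x hx ↦ Ideal.mul_mem_right c.unop X hx }
  obtain ⟨y, hy, hya⟩ := exists_mem_mul_eq_of_annihilates N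
    (IsNoetherian.noetherian X') (a := a) fun s hs hsX ↦
      h s hs fun x hx ↦ hsX (MulOpposite.op x) hx
  exact ⟨y.unop, hy, hya⟩

variable [IsArtinianRing R]

/-- The left annihilator of the left socle is contained in the Jacobson radical. Here `T X` is
`S ∩ l(X)` and `Ψ X = l(T X)`; since `X` is recovered from `Ψ X`, the monotone map `Ψ` is strictly
monotone on the two-sided ideals containing `J`, and the ascending chain condition forces
`Ψ J = J`. -/
lemma leftAnn_leftSocle_le : leftAnn (leftSocle R : Set R) ≤ Ring.jacobson R := by
  let T : Ideal R → Ideal R := fun X ↦ leftSocle R ⊓ leftAnn (X : Set R)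
  let Ψ : Ideal R → Ideal R := fun X ↦ leftAnn (T X : Set R)
  have hT : ∀ X : Ideal R, (T X).IsTwoSided := fun X ↦
    ⟨fun b hx ↦ ⟨Ideal.mul_mem_right b _ hx.1, Ideal.mul_mem_right b _ hx.2⟩⟩
  have hT_anti : ∀ {X Y : Ideal R}, X ≤ Y → T Y ≤ T X := fun h ↦
    inf_le_inf_left _ (leftAnn_anti h)
  have hΨ_mono : ∀ {X Y : Ideal R}, X ≤ Y → Ψ X ≤ Ψ Y := fun h ↦ leftAnn_anti (hT_anti h)
  have hJΨ : ∀ X : Ideal R, Ring.jacobson R ≤ Ψ X := fun X a ha x hx ↦ hx.1 a ha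
  -- `T X` is recovered from `Ψ X` as its right annihilator.
  have hT_of_Ψ : ∀ (X : Ideal R) (t : R), (∀ a ∈ Ψ X, a * t = 0) → t ∈ T X := by
    intro X t ht
    obtain ⟨y, hy, h⟩ := exists_mem_mul_eq_of_annihilates_twoSided ⊤ (T X) (a := t)
      fun s _ hs ↦ ht s hs
    have := h 1 trivial
    rw [one_mul, one_mul] at this
    rwa [this]
  -- A two-sided ideal `X` containing the radical is recovered from `T X` as its right annihilator.
  have hX_of_T : ∀ X : Ideal R, X.IsTwoSided → Ring.jacobson R ≤ X →
      ∀ a, (∀ t ∈ T X, t * a = 0) → a ∈ X := by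
    intro X _ hJX a ha
    obtain ⟨y, hy, h⟩ := exists_mem_mul_eq_of_annihilates_twoSided (leftSocle R) X (a := a)
      fun s hs hsX ↦ ha s ⟨hs, hsX⟩
    have hJ : a - y ∈ Ring.jacobson R :=
      mem_jacobson_of_leftSocle_mul_eq_zero fun s hs ↦ by rw [mul_sub, h s hs, sub_self]
    simpa using X.add_mem (hJX hJ) hy
  have hΨ_inj : ∀ X Y : Ideal R, X.IsTwoSided → Ring.jacobson R ≤ X → X ≤ Y → Ψ X = Ψ Y →
      X = Y := by
    intro X Y hX hJX hXY h
    refine le_antisymm hXY fun y hy ↦ hX_of_T X hX hJX y fun t ht ↦ ?_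
    exact (hT_of_Ψ Y t fun a ha ↦ (h.symm ▸ ha : a ∈ Ψ X) t ht).2 y hy
  have hfix : Ψ (Ring.jacobson R) ≤ Ring.jacobson R := by
    by_contra hne
    -- Otherwise `J < Ψ J < Ψ (Ψ J) < ⋯`, which a maximal `X` with `X < Ψ X` makes precise.
    obtain ⟨X, ⟨hX, hJX, hlt⟩, hmax⟩ := WellFounded.has_min
      (wellFounded_gt (α := Ideal R))
      {X | X.IsTwoSided ∧ Ring.jacobson R ≤ X ∧ X < Ψ X}
      ⟨Ring.jacobson R, inferInstance, le_rfl, lt_of_le_not_ge (hJΨ _) hne⟩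
    have : (T X).IsTwoSided := hT X
    refine hmax (Ψ X) ⟨isTwoSided_leftAnn _, hJΨ X, lt_of_le_of_ne (hΨ_mono hlt.le) fun h ↦ ?_⟩ hlt
    exact hlt.ne (hΨ_inj X (Ψ X) hX hJX hlt.le h)
  exact (leftAnn_anti (inf_le_left : T (Ring.jacobson R) ≤ leftSocle R)).trans hfix

/-- Every simple left module embeds in `R`: a maximal left ideal `P` kills some nonzero element.
With `Q` a complement of `P` modulo `J` one has `P q ⊆ P ∩ Q ⊆ J` for the component `q ∈ Q` of `1`,
so `P` kills `q S`, which is nonzero as the left annihilator of `S` is `J`. -/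
lemma exists_ne_zero_annihilated {P : Ideal R} (hP : P.IsMaximal) :
    ∃ s : R, s ≠ 0 ∧ ∀ p ∈ P, p * s = 0 := by
  have hJP : Ring.jacobson R ≤ P := Ring.jacobson_le_of_isMaximal P
  obtain ⟨Q, hQ⟩ := exists_isCompl (P.map (Ideal.Quotient.mk (Ring.jacobson R)))
  have hmemP : ∀ p, Ideal.Quotient.mk (Ring.jacobson R) p ∈
      P.map (Ideal.Quotient.mk (Ring.jacobson R)) → p ∈ P := by
    intro p hp
    obtain ⟨p', hp', h⟩ :=
      (Ideal.mem_map_iff_of_surjective _ Ideal.Quotient.mk_surjective).mp hp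
    simpa using P.sub_mem hp' (hJP (Ideal.Quotient.eq.mp h))
  obtain ⟨p₀, hp₀, q₀, hq₀, h1⟩ := Submodule.mem_sup.mp
    (hQ.codisjoint.eq_top.ge (Submodule.mem_top (x := 1)))
  obtain ⟨q, rfl⟩ := Ideal.Quotient.mk_surjective q₀
  have hq : q ∉ Ring.jacobson R := by
    intro hq
    rw [Ideal.Quotient.eq_zero_iff_mem.mpr hq, add_zero] at h1
    exact hP.ne_top ((Ideal.eq_top_iff_one P).mpr (hmemP 1 (by rwa [map_one, ← h1])))
  have hPq : ∀ p ∈ P, p * q ∈ Ring.jacobson R := by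
    intro p hp
    have hpP := Ideal.mem_map_of_mem (Ideal.Quotient.mk (Ring.jacobson R)) hp
    rw [← Ideal.Quotient.eq_zero_iff_mem, map_mul]
    refine (Submodule.disjoint_def.mp hQ.disjoint) _ ?_ (Q.mul_mem_left _ hq₀)
    rw [← eq_sub_iff_add_eq'] at h1
    rw [h1, mul_sub, mul_one]
    exact Ideal.sub_mem _ hpP (Ideal.mul_mem_left _ _ hp₀)
  have hqS : q ∉ leftAnn (leftSocle R : Set R) := fun h ↦ hq (leftAnn_leftSocle_le h)
  rw [mem_leftAnn] at hqS
  push Not at hqS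
  obtain ⟨s, hs, hqs⟩ := hqS
  exact ⟨q * s, hqs, fun p hp ↦ by rw [← mul_assoc]; exact hs _ (hPq p hp)⟩

/-- The double annihilator property of left ideals. -/
lemma exists_annihilator_mul_ne_zero {L : Ideal R} {x : R} (hx : x ∉ L) :
    ∃ c : R, (∀ t ∈ L, t * c = 0) ∧ x * c ≠ 0 := by
  obtain ⟨M, ⟨hLM, hxM⟩, hmax⟩ := WellFounded.has_min (wellFounded_gt (α := Ideal R))
    {M | L ≤ M ∧ x ∉ M} ⟨L, le_rfl, hx⟩
  let f : R →ₗ[R] R ⧸ M := M.mkQ ∘ₗ LinearMap.toSpanSingleton R R x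
  have hmem : ∀ a, a ∈ LinearMap.ker f ↔ a * x ∈ M := fun a ↦ by
    rw [LinearMap.mem_ker]
    exact Submodule.Quotient.mk_eq_zero M
  have hP : Ideal.IsMaximal (LinearMap.ker f) := by
    refine ⟨⟨fun h ↦ hxM ?_, fun Q hQ ↦ ?_⟩⟩
    · simpa using (hmem 1).mp (h ▸ trivial)
    · obtain ⟨a, haQ, ha⟩ := SetLike.exists_of_lt hQ
      rw [hmem] at ha
      have hx' : x ∈ M ⊔ Ideal.span {a * x} := by
        by_contra hx'
        refine hmax _ ⟨hLM.trans le_sup_left, hx'⟩ (lt_of_le_of_ne le_sup_left fun h ↦ ha ?_)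
        rw [h]
        exact Ideal.mem_sup_right (Ideal.mem_span_singleton_self _)
      obtain ⟨m, hm, z, hz, hmz⟩ := Submodule.mem_sup.mp hx'
      obtain ⟨b, rfl⟩ := Ideal.mem_span_singleton'.mp hz
      have h1 : 1 - b * a ∈ LinearMap.ker f := by
        rw [hmem, sub_mul, one_mul, mul_assoc, ← eq_sub_of_add_eq hmz]
        exact hm
      rw [Ideal.eq_top_iff_one]
      simpa using Q.add_mem (hQ.le h1) (Q.mul_mem_left b haQ)
  obtain ⟨s, hs0, hs⟩ := exists_ne_zero_annihilated hP
  obtain ⟨e, he⟩ := exists_extension f (LinearMap.toSpanSingleton R R s) hs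
  have he' : ∀ r, e (M.mkQ r) = r * e (M.mkQ 1) := fun r ↦ by
    rw [← smul_eq_mul, ← map_smul, ← map_smul, smul_eq_mul, mul_one]
  refine ⟨e (M.mkQ 1), fun t ht ↦ ?_, ?_⟩
  · rw [← he', Submodule.mkQ_apply, (Submodule.Quotient.mk_eq_zero M).mpr (hLM ht), map_zero]
  · have := he 1
    simp only [f, LinearMap.comp_apply, LinearMap.toSpanSingleton_apply, one_smul] at this
    rwa [← he', this]

end DoubleAnnihilator

/-! ### Right self-injectivity -/

section RightInjective

variable {R : Type v} [Ring R] [IsArtinianRing R] [Module.Injective R R] [IsNoetherianRing Rᵐᵒᵖ]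

/-- The left annihilator of an intersection of right ideals is the sum of the left annihilators. -/
lemma exists_add_eq_of_annihilates_inf (X Y : Ideal Rᵐᵒᵖ) {d : R}
    (hd : ∀ x ∈ X ⊓ Y, d * x.unop = 0) :
    ∃ u v : R, u + v = d ∧ (∀ x ∈ X, u * x.unop = 0) ∧ ∀ y ∈ Y, v * y.unop = 0 := by
  have mem_of : ∀ (Z : Ideal Rᵐᵒᵖ) (c : R),
      (∀ s ∈ leftAnn (MulOpposite.op ⁻¹' (Z : Set Rᵐᵒᵖ)), s * c = 0) →
      MulOpposite.op c ∈ Z := by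
    intro Z c hc
    obtain ⟨y, hy, h⟩ := exists_mem_mul_eq_of_annihilates ⊤ (IsNoetherian.noetherian Z) (a := c)
      fun s _ hs ↦ hc s fun z hz ↦ hs _ hz
    have := h 1 trivial
    rw [one_mul, one_mul] at this
    rwa [this, MulOpposite.op_unop]
  have hd' : d ∈ leftAnn (MulOpposite.op ⁻¹' (X : Set Rᵐᵒᵖ)) ⊔
      leftAnn (MulOpposite.op ⁻¹' (Y : Set Rᵐᵒᵖ)) := by
    by_contra hd'
    obtain ⟨c, hc, hdc⟩ := exists_annihilator_mul_ne_zero hd'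
    exact hdc (hd (MulOpposite.op c)
      ⟨mem_of X c fun s hs ↦ hc s (Ideal.mem_sup_left hs),
        mem_of Y c fun s hs ↦ hc s (Ideal.mem_sup_right hs)⟩)
  obtain ⟨u, hu, v, hv, huv⟩ := Submodule.mem_sup.mp hd'
  exact ⟨u, v, huv, fun x hx ↦ hu x.unop hx, fun y hy ↦ hv y.unop hy⟩

/-- Homomorphisms from a right ideal to the ring are left multiplications. -/
lemma exists_eq_mul_of_rightIdeal (X : Ideal Rᵐᵒᵖ) (g : X →ₗ[Rᵐᵒᵖ] R) :
    ∃ a : R, ∀ x : X, g x = a * (x : Rᵐᵒᵖ).unop := by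
  induction X, IsNoetherian.noetherian X using Submodule.fg_induction with
  | singleton x =>
    let x₀ : Submodule.span Rᵐᵒᵖ {x} := ⟨x, Submodule.mem_span_singleton_self x⟩
    have hx : g x₀ ∈ Ideal.span {x.unop} := by
      by_contra hx
      obtain ⟨c, hc, hne⟩ := exists_annihilator_mul_ne_zero hx
      have h0 : MulOpposite.op c • x₀ = 0 := Subtype.ext <| MulOpposite.unop_injective <|
        hc _ (Ideal.mem_span_singleton_self _)
      refine hne ?_
      have := map_smul g (MulOpposite.op c) x₀
      rw [h0, map_zero] at this
      exact this.symm
    obtain ⟨a, ha⟩ := Ideal.mem_span_singleton'.mp hx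
    refine ⟨a, fun ⟨y, hy⟩ ↦ ?_⟩
    obtain ⟨c, rfl⟩ := Submodule.mem_span_singleton.mp hy
    have h1 : g (c • x₀) = c • g x₀ := map_smul g c x₀
    rw [← ha] at h1
    refine h1.trans ?_
    exact mul_assoc a x.unop c.unop
  | sup X Y hX hY ihX ihY =>
    obtain ⟨a, ha⟩ := ihX (g ∘ₗ Submodule.inclusion le_sup_left)
    obtain ⟨b, hb⟩ := ihY (g ∘ₗ Submodule.inclusion le_sup_right)
    obtain ⟨u, v, huv, hu, hv⟩ := exists_add_eq_of_annihilates_inf X Y (d := a - b) (by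
      intro x hx
      have h1 := ha ⟨x, hx.1⟩
      have h2 := hb ⟨x, hx.2⟩
      rw [sub_mul, sub_eq_zero]
      exact h1.symm.trans h2)
    -- Left multiplication by `a - u = b + v` agrees with `g` on both summands.
    refine ⟨a - u, fun ⟨z, hz⟩ ↦ ?_⟩
    obtain ⟨x, hx, y, hy, rfl⟩ := Submodule.mem_sup.mp hz
    have h1 : g ⟨x, Submodule.mem_sup_left hx⟩ = a * x.unop := ha ⟨x, hx⟩
    have h2 : g ⟨y, Submodule.mem_sup_right hy⟩ = b * y.unop := hb ⟨y, hy⟩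
    have h3 := map_add g ⟨x, Submodule.mem_sup_left hx⟩ ⟨y, Submodule.mem_sup_right hy⟩
    have h4 : a - u = b + v := by rw [sub_eq_iff_eq_add, add_assoc, add_comm v, huv]; abel
    refine h3.trans ?_
    rw [h1, h2, MulOpposite.unop_add, mul_add]
    congr 1
    · rw [sub_mul, hu x hx, sub_zero]
    · rw [h4, add_mul, hv y hy, add_zero]

variable (R) in
/-- A left self-injective ring which is left artinian and right noetherian is right
self-injective. -/
theorem injective_mulOpposite : Module.Injective Rᵐᵒᵖ R := by
  refine Module.Baer.injective fun X g ↦ ?_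
  obtain ⟨a, ha⟩ := exists_eq_mul_of_rightIdeal X g
  exact ⟨LinearMap.toSpanSingleton Rᵐᵒᵖ R a, fun x hx ↦ (ha ⟨x, hx⟩).symm⟩

end RightInjective

/-! ### Profinite algebras -/

theorem finiteDimensional_of_isProfiniteAlgebra (k : Type u) (A : Type v) [Field k] [Ring A]
    [Algebra k A] [IsSemiprimaryRing A] [Module.Injective A A]
    (h : IsProfiniteAlgebra.{u, v, w, w'} k A) : FiniteDimensional k A := by
  obtain ⟨ι, _, _, _, F, _, _, f, -, hF, ⟨e⟩⟩ := h
  let π : ∀ i, A →ₐ[k] F i := fun i ↦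
    (Pi.evalAlgHom k F i).comp ((inverseLimit f).val.comp e.toAlgHom)
  have hπ : ∀ ⦃i j⦄ (hij : i ≤ j) (x : A), f hij (π j x) = π i x := fun i j hij x ↦
    (e x).2 hij
  obtain ⟨i, hi⟩ := exists_eq_bot_of_directed (fun i ↦ RingHom.ker (π i)) (by
      refine directed_of_isDirected_le fun i j hij x hx ↦ ?_
      rw [RingHom.mem_ker] at hx ⊢
      rw [← hπ hij, hx, map_zero]) (by
      refine (Submodule.eq_bot_iff _).mpr fun x hx ↦ ?_
      rw [Submodule.mem_iInf] at hx
      refine e.injective (Subtype.ext (funext fun i ↦ ?_))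
      rw [map_zero]
      exact hx i)
  exact FiniteDimensional.of_injective (π i).toLinearMap
    ((RingHom.injective_iff_ker_eq_bot (π i)).mpr hi)

end SelfInjective

theorem corollary5p3 (k : Type u) (A : Type v) [Field k] [Ring A] [Algebra k A]
    (hprofinite : IsProfiniteAlgebra.{u, v, w, w'} k A)
    (hsemiprimary : IsSemiprimaryRing A)
    (hinjective : IsLeftSelfInjective A) :
    FiniteDimensional k A ∧ IsQuasiFrobeniusRing A := by
  have hinj : Module.Injective A A := hinjective
  have hfin := SelfInjective.finiteDimensional_of_isProfiniteAlgebra k A hprofinite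
  have hleft : IsArtinian A A := isArtinian_of_tower k inferInstance
  have hright : IsArtinian Aᵐᵒᵖ A := isArtinian_of_tower k inferInstance
  have hnoeth : IsNoetherianRing Aᵐᵒᵖ := isNoetherian_of_tower k inferInstance
  exact ⟨hfin, hinjective, SelfInjective.injective_mulOpposite A, hleft, hright⟩
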